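/- Throughout, digraphs are finite and non-empty, have no loops and no parallel arcs, but may contain pairs of antiparallel arcs. For a digraph $D$, let $\delta^+(D)$ denote its minimum out-degree, and let $\vec g(D)$ denote its directed girth, i.e. the minimum length of a directed cycle in $D$ (with $\vec g(D)=\infty$ if there is none; a pair of antiparallel arcs is a directed cycle of length $2$). A subdivision of a digraph $F$ is a digraph obtained from $F$ by replacing every arc $(x,y)$ by a directed path from $x$ to $y$, where the paths replacing different arcs are internally vertex-disjoint and their internal vertices are not vertices of $F$. A digraph $D$ contains a subdivision of $F$ if some (not necessarily induced) subdigraph of $D$ is isomorphic to a subdivision of $F$. For integers $a,b\ge 1$, let $C_{a,b}$ be the oriented cycle consisting of $2a$ distinct vertices $s_1,\dots,s_a,t_1,\dots,t_a$ and $2a$ internally vertex-disjoint directed paths of length $b$: for each $1\le i\le a$, one from $s_i$ to $t_i$ and one from $s_i$ to $t_{i+1}$ (indices modulo $a$). **Theorem.** There is an absolute constant $C$ such that for every pair of integers $a\ge 2$, $b\ge 1$, every digraph $D$ with $\delta^+(D)\ge C\,a\,b^7$ and $\vec g(D)\ge 4b^2$ contains a subdivision of $C_{a,b}$. -/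

import Mathlib

/-- A digraph without loops. Since a `Digraph` is a relation, there are no parallel arcs;
antiparallel pairs of arcs (digons) are allowed. -/
def Digraph.IsLoopless {V : Type*} (D : Digraph V) : Prop :=
  ∀ v, ¬ D.Adj v v

/-- The out-degree of `v`: the number of its out-neighbours. -/
noncomputable def Digraph.outDegree {V : Type*} (D : Digraph V) (v : V) : ℕ :=
  {w | D.Adj v w}.ncard

/-- The minimum out-degree of a digraph (on a finite nonempty vertex set). -/
noncomputable def Digraph.minOutDegree {V : Type*} (D : Digraph V) : ℕ :=
  ⨅ v, D.outDegree v

/-- `l` is the list of vertices, in order, of a directed path of `D` from `x` to `y`: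
the vertices are pairwise distinct, and there is an arc from each vertex to the next one. -/
structure Digraph.IsDipath {V : Type*} (D : Digraph V) (x y : V) (l : List V) : Prop where
  head_eq : l.head? = some x
  last_eq : l.getLast? = some y
  nodup : l.Nodup
  chain : l.IsChain D.Adj

/-- `l` is the list of vertices, in order, of a directed cycle of `D`:
a directed path that is closed by an arc from its last vertex to its first vertex.
The length of the cycle is `l.length`. -/
def Digraph.IsDicycle {V : Type*} (D : Digraph V) (l : List V) : Prop :=
  ∃ x y, D.IsDipath x y l ∧ D.Adj y x

/-- The directed girth: the minimum length of a directed cycle (`⊤` if there is none). -/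
noncomputable def Digraph.directedGirth {V : Type*} (D : Digraph V) : ℕ∞ :=
  ⨅ (l : List V) (_ : D.IsDicycle l), (l.length : ℕ∞)

/-- `D` contains a subdivision of the loopless digraph `F` as a (not necessarily induced)
subdigraph. The vertices `w` of `F` are placed at distinct branch vertices `φ w` of `D`, and every
arc `(x, y)` of `F` is replaced by a dipath `P x y` of `D` from `φ x` to `φ y`. No branch vertex is
an interior vertex of one of these dipaths, and dipaths replacing different arcs share no vertex
except possibly branch vertices. -/
def Digraph.ContainsSubdivision {V W : Type*} (D : Digraph V) (F : Digraph W) : Prop :=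
  ∃ (φ : W → V) (P : W → W → List V),
    Function.Injective φ ∧
    (∀ x y, F.Adj x y → D.IsDipath (φ x) (φ y) (P x y)) ∧
    (∀ x y, F.Adj x y → ∀ w, φ w ∈ P x y → w = x ∨ w = y) ∧
    (∀ x y x' y', F.Adj x y → F.Adj x' y' → (x, y) ≠ (x', y') →
      ∀ v, v ∈ P x y → v ∈ P x' y' → v ∈ Set.range φ)

/-- The vertices of the oriented cycle `C_{a,b}` (for `a, b ≥ 1`): the sources `s i`, the sinks
`t i`, and the vertices `inner i c j` with `0 < j < b`, where `inner i c j` is the vertex at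
distance `j` from `s i` on the dipath from `s i` to `t i` (if `c = false`) or on the dipath from
`s i` to `t (i + 1)` (if `c = true`). Indices `i` are taken modulo `a`. -/
inductive OrientedCycleVertex (a b : ℕ) : Type
  | s (i : ZMod a) : OrientedCycleVertex a b
  | t (i : ZMod a) : OrientedCycleVertex a b
  | inner (i : ZMod a) (c : Bool) (j : ℕ) (pos : 0 < j) (lt : j < b) : OrientedCycleVertex a b

/-- The `j`-th vertex (`0 ≤ j ≤ b`) of the dipath of length `b` from `s i` to
`t i` (if `c = false`) or from `s i` to `t (i + 1)` (if `c = true`). -/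
def OrientedCycleVertex.onPath {a b : ℕ} (i : ZMod a) (c : Bool) (j : ℕ) :
    OrientedCycleVertex a b :=
  if h₀ : j = 0 then .s i
  else if h : j < b then .inner i c j (Nat.pos_of_ne_zero h₀) h
  else .t (if c then i + 1 else i)

/-- The oriented cycle `C_{a,b}`: for every `i` modulo `a`, there are a dipath of length `b` from
`s i` to `t i` and a dipath of length `b` from `s i` to `t (i + 1)`, and these `2 * a` dipaths
are internally disjoint. -/
def orientedCycle (a b : ℕ) : Digraph (OrientedCycleVertex a b) where
  Adj u v := ∃ (i : ZMod a) (c : Bool) (j : ℕ), j < b ∧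
    u = OrientedCycleVertex.onPath i c j ∧ v = OrientedCycleVertex.onPath i c (j + 1)

theorem orientedCycle_isLoopless (a b : ℕ) : (orientedCycle a b).IsLoopless := by
  rintro v ⟨i, c, j, hj, h1, h2⟩
  rw [h1] at h2
  unfold OrientedCycleVertex.onPath at h2
  split_ifs at h2 <;> simp_all

/-! Out-degree of order `a * b ^ 2` already suffices. Call two dipaths from a common root, otherwise
disjoint, a fork. A copy of `C_{a,b}` is a cyclic sequence of `a` disjoint forks with long legs, in
which consecutive forks are joined at a sink.

Take an inclusion-minimal nonempty set `X` with small out-boundary. Vertices of `X` keep large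
out-degree inside `X`, and any two of them reach a common vertex while avoiding any prescribed small
set (`exists_common_reachable`). This is what closes the cycle at the end.

Inside `X` there is a family of disjoint forks with legs of between `b` and `2 * b` arcs, such that
every tip sends many arcs to the union `U` of the forks (`exists_fork_family`). Since `U` has only
`O(b)` vertices per fork, a density argument gives a subfamily and a set of points of `U` in which
each tip sees many of the points and each point is seen from many forks (`exists_rich_subfamily`). A
greedy walk then alternates between forks and points and produces a chain of `a` forks
(`exists_fork_chain`). Its two free tips are joined to a common end by dipaths avoiding the rest of
the chain (`containsSubdivision_of_fork_chain`). -/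

namespace Digraph

/-! ### Segments of dipaths. -/

variable {V : Type*} {D : Digraph V}

theorem IsDipath.extract {x y : V} {l : List V} (h : D.IsDipath x y l) {p q : ℕ} {u v : V}
    (hpq : p ≤ q) (hp : l[p]? = some u) (hq : l[q]? = some v) :
    D.IsDipath u v ((l.take (q + 1)).drop p) := by
  refine ⟨?_, ?_, h.nodup.sublist ((List.drop_sublist _ _).trans (List.take_sublist _ _)),
    (h.chain.take _).drop _⟩
  · rw [List.head?_drop, List.getElem?_take_of_lt (by omega), hp]
  · have hlt : q < l.length := (List.getElem?_eq_some_iff.mp hq).1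
    rw [List.getLast?_drop, if_neg (by simp; omega), List.getLast?_take, if_neg (by omega)]
    simp [hq]

theorem _root_.List.mem_drop_take_iff {l : List V} {p q : ℕ} {v : V} :
    v ∈ (l.take (q + 1)).drop p ↔ ∃ r, p ≤ r ∧ r ≤ q ∧ l[r]? = some v := by
  rw [List.mem_iff_getElem?]
  constructor
  · rintro ⟨i, hi⟩
    rw [List.getElem?_drop] at hi
    have : p + i < q + 1 := by
      by_contra hc
      rw [List.getElem?_take_eq_none (by omega)] at hi
      simp at hi
    rw [List.getElem?_take_of_lt this] at hi
    exact ⟨p + i, by omega, by omega, hi⟩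
  · rintro ⟨r, h1, h2, h3⟩
    refine ⟨r - p, ?_⟩
    rw [List.getElem?_drop, List.getElem?_take_of_lt (by omega)]
    rwa [Nat.add_sub_cancel' h1]

theorem _root_.List.Nodup.eq_of_getElem?_eq_some {l : List V} (h : l.Nodup) {p q : ℕ} {v : V}
    (hp : l[p]? = some v) (hq : l[q]? = some v) : p = q :=
  (List.getElem?_inj (List.getElem?_eq_some_iff.mp hp).1 h).1 (hp.trans hq.symm)

end Digraph

/-! ### Assembling a subdivision of `C_{a,b}` from its `2 * a` long dipaths. -/

namespace OrientedCycleVertex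

variable {a b : ℕ}

theorem onPath_zero (i : ZMod a) (c : Bool) : (onPath i c 0 : OrientedCycleVertex a b) = .s i := by
  simp [onPath]

theorem onPath_of_lt (i : ZMod a) (c : Bool) {j : ℕ} (h₀ : 0 < j) (h : j < b) :
    (onPath i c j : OrientedCycleVertex a b) = .inner i c j h₀ h := by
  simp [onPath, h₀.ne', h]

theorem onPath_last (i : ZMod a) (c : Bool) (hb : 1 ≤ b) :
    (onPath i c b : OrientedCycleVertex a b) = .t (if c then i + 1 else i) := by
  simp only [onPath, lt_irrefl, dite_false]
  exact dif_neg (by omega)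

theorem exists_onPath (hb : 1 ≤ b) (w : OrientedCycleVertex a b) :
    ∃ i c j, j ≤ b ∧ w = onPath i c j := by
  cases w with
  | s i => exact ⟨i, false, 0, by omega, (onPath_zero i false).symm⟩
  | t i => exact ⟨i, false, b, le_rfl, by simp [onPath_last i false hb]⟩
  | inner i c j pos lt => exact ⟨i, c, j, lt.le, (onPath_of_lt i c pos lt).symm⟩

end OrientedCycleVertex

open OrientedCycleVertex in
/-- `2 * a` dipaths of length at least `b`, joining sources to sinks in the pattern of `C_{a,b}` and
meeting only there, form a subdivision of `C_{a,b}`. -/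
theorem Digraph.containsSubdivision_orientedCycle_of_blocks {V : Type*} {D : Digraph V} {a b : ℕ}
    (hb : 1 ≤ b) (S T : ZMod a → V) (B : ZMod a → Bool → List V)
    (hB : ∀ i c, D.IsDipath (S i) (T (if c then i + 1 else i)) (B i c))
    (hlen : ∀ i c, b < (B i c).length)
    (hS : ∀ i' i c, S i' ∈ B i c → i' = i)
    (hT : ∀ i' i c, T i' ∈ B i c → i' = if c then i + 1 else i)
    (hdisj : ∀ i c i' c', (i, c) ≠ (i', c') → ∀ v, v ∈ B i c → v ∈ B i' c' →
      (∃ j, v = S j) ∨ ∃ j, v = T j) :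
    D.ContainsSubdivision (orientedCycle a b) := by
  classical
  -- Position in the block of the `j`-th branch vertex. The first `b` of them sit at the first `b`
  -- positions and the last one at the end, so the last arc absorbs all surplus length.
  let st : ZMod a → Bool → ℕ → ℕ := fun i c j => if j < b then j else (B i c).length - 1
  let φ : OrientedCycleVertex a b → V := fun w => match w with
    | .s i => S i
    | .t i => T i
    | .inner i c j _ _ => ((B i c)[j]?).getD (S i)
  have hst : ∀ i c j j', j < j' → j' ≤ b → st i c j < st i c j' := by
    intro i c j j' h1 h2
    have := hlen i c
    simp only [st]
    split_ifs <;> omega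
  have hst' : ∀ i c j j', j' ≤ b → st i c j ≤ st i c j' → j ≤ b → j ≤ j' := by
    intro i c j j' h1 h2 h3
    by_contra hlt
    have := hst i c j' j (by omega) h3
    omega
  have hφ : ∀ i c j, j ≤ b → (B i c)[st i c j]? = some (φ (onPath i c j)) := by
    intro i c j hj
    have hl := hlen i c
    rcases Nat.eq_zero_or_pos j with rfl | h0
    · rw [onPath_zero]
      have := (hB i c).head_eq
      rw [List.head?_eq_getElem?] at this
      simpa [st, φ, (by omega : 0 < b)] using this
    rcases hj.lt_or_eq with h | rfl
    · rw [onPath_of_lt i c h0 h]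
      simp [st, φ, h, (by omega : j < (B i c).length)]
    · rw [onPath_last i c hb]
      have := (hB i c).last_eq
      rw [List.getLast?_eq_getElem?] at this
      simpa [st, φ] using this
  have hmem : ∀ i c j, j ≤ b → φ (onPath i c j) ∈ B i c := fun i c j hj =>
    List.mem_of_getElem? (hφ i c j hj)
  have hpos : ∀ i c w, φ w ∈ B i c → ∃ j, j ≤ b ∧ w = onPath i c j := by
    intro i c w hw
    cases w with
    | s i' =>
      obtain rfl := hS i' i c hw
      exact ⟨0, by omega, (onPath_zero _ _).symm⟩
    | t i' =>
      obtain rfl := hT i' i c hw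
      exact ⟨b, le_rfl, (onPath_last _ _ hb).symm⟩
    | inner i' c' j pos lt =>
      have hw' := onPath_of_lt i' c' pos lt
      by_cases heq : (i, c) = (i', c')
      · obtain ⟨rfl, rfl⟩ := Prod.mk.inj heq
        exact ⟨j, lt.le, hw'.symm⟩
      exfalso
      rw [← hw'] at hw
      have hj := hφ i' c' j lt.le
      -- An inner branch vertex on a foreign block would be a source or a sink, hence at the first
      -- or last position of its own block. Strict monotonicity of `st` excludes both.
      rcases hdisj i c i' c' heq _ hw (hmem i' c' j lt.le) with ⟨k, hk⟩ | ⟨k, hk⟩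
      · have h1 := hS k i' c' (hk ▸ hmem i' c' j lt.le)
        have h0 := hφ i' c' 0 (by omega)
        rw [onPath_zero] at h0
        rw [hk, h1] at hj
        have := (hB i' c').nodup.eq_of_getElem?_eq_some hj h0
        have := hst i' c' 0 j pos lt.le
        omega
      · have h1 := hT k i' c' (hk ▸ hmem i' c' j lt.le)
        have h0 := hφ i' c' b le_rfl
        rw [onPath_last _ _ hb] at h0
        rw [hk, h1] at hj
        have := (hB i' c').nodup.eq_of_getElem?_eq_some hj h0
        have := hst i' c' j b lt le_rfl
        omega
  -- An arc is given by its ends only, so its indices `(i, c, j)` are chosen; their uniqueness is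
  -- never needed.
  let P : OrientedCycleVertex a b → OrientedCycleVertex a b → List V := fun x y =>
    if h : ∃ (i : ZMod a) (c : Bool) (j : ℕ), j < b ∧ x = onPath i c j ∧ y = onPath i c (j + 1) then
      ((B h.choose h.choose_spec.choose).take
        (st h.choose h.choose_spec.choose (h.choose_spec.choose_spec.choose + 1) + 1)).drop
        (st h.choose h.choose_spec.choose h.choose_spec.choose_spec.choose)
    else []
  have hP : ∀ x y, (orientedCycle a b).Adj x y → ∃ i c j, j < b ∧ x = onPath i c j ∧
      y = onPath i c (j + 1) ∧
      P x y = ((B i c).take (st i c (j + 1) + 1)).drop (st i c j) := by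
    intro x y h
    change ∃ (i : ZMod a) (c : Bool) (j : ℕ), j < b ∧ x = onPath i c j ∧
      y = onPath i c (j + 1) at h
    exact ⟨h.choose, h.choose_spec.choose, h.choose_spec.choose_spec.choose,
      h.choose_spec.choose_spec.choose_spec.1, h.choose_spec.choose_spec.choose_spec.2.1,
      h.choose_spec.choose_spec.choose_spec.2.2, dif_pos h⟩
  refine ⟨φ, P, ?_, ?_, ?_, ?_⟩
  · intro w w' hww
    obtain ⟨i, c, j, hj, rfl⟩ := exists_onPath hb w
    obtain ⟨j', hj', rfl⟩ := hpos i c w' (hww ▸ hmem i c j hj)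
    have h1 := (hB i c).nodup.eq_of_getElem?_eq_some (hφ i c j hj) (hww ▸ hφ i c j' hj')
    rw [le_antisymm (hst' i c j j' hj' h1.le hj) (hst' i c j' j hj h1.ge hj')]
  · intro x y h
    obtain ⟨i, c, j, hj, rfl, rfl, hPxy⟩ := hP x y h
    rw [hPxy]
    exact (hB i c).extract (hst i c j (j + 1) (by omega) hj).le (hφ i c j hj.le) (hφ i c _ hj)
  · intro x y h w hw
    obtain ⟨i, c, j, hj, rfl, rfl, hPxy⟩ := hP x y h
    rw [hPxy, List.mem_drop_take_iff] at hw
    obtain ⟨r, hr1, hr2, hr⟩ := hw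
    obtain ⟨j', hj', rfl⟩ := hpos i c w (List.mem_of_getElem? hr)
    have h1 := (hB i c).nodup.eq_of_getElem?_eq_some hr (hφ i c j' hj')
    have h2 := hst' i c j j' hj' (by omega) hj.le
    have h3 := hst' i c j' (j + 1) hj (by omega) hj'
    rcases (by omega : j' = j ∨ j' = j + 1) with rfl | rfl
    · exact Or.inl rfl
    · exact Or.inr rfl
  · intro x y x' y' h h' hne v hv hv'
    obtain ⟨i, c, j, hj, rfl, rfl, hPxy⟩ := hP x y h
    obtain ⟨i', c', j', hj', rfl, rfl, hPxy'⟩ := hP x' y' h'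
    rw [hPxy, List.mem_drop_take_iff] at hv
    rw [hPxy', List.mem_drop_take_iff] at hv'
    obtain ⟨r, hr1, hr2, hr⟩ := hv
    obtain ⟨r', hr1', hr2', hr'⟩ := hv'
    by_cases heq : (i, c) = (i', c')
    · obtain ⟨rfl, rfl⟩ := Prod.mk.inj heq
      obtain rfl := (hB i c).nodup.eq_of_getElem?_eq_some hr hr'
      -- Segments of one block belonging to different arcs can only share the position `st i c k'`,
      -- which holds a branch vertex.
      have key : ∀ k k', k < k' → k' < b → st i c k' ≤ r → r ≤ st i c (k + 1) →
          v ∈ Set.range φ := by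
        intro k k' h1 h2 h3 h4
        have h5 : st i c (k + 1) ≤ st i c k' := by
          rcases (by omega : k + 1 = k' ∨ k + 1 < k') with h | h
          · rw [h]
          · exact (hst i c _ _ h h2.le).le
        have h6 := hφ i c k' h2.le
        rw [(by omega : st i c k' = r), hr] at h6
        exact ⟨_, (Option.some.inj h6).symm⟩
      rcases lt_trichotomy j j' with hlt | rfl | hlt
      · exact key j j' hlt hj' hr1' hr2
      · exact absurd rfl hne
      · exact key j' j hlt hj hr1 hr2'
    · rcases hdisj i c i' c' heq v (List.mem_of_getElem? hr) (List.mem_of_getElem? hr') with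
        ⟨k, rfl⟩ | ⟨k, rfl⟩
      · exact ⟨.s k, rfl⟩
      · exact ⟨.t k, rfl⟩

/-! ### Joining dipaths, and dipaths that merge. -/

namespace Digraph

variable {V : Type*} {D : Digraph V}

theorem isDipath_singleton (x : V) : D.IsDipath x x [x] :=
  ⟨rfl, rfl, List.nodup_singleton x, List.isChain_singleton x⟩

theorem isDipath_pair {x y : V} (h : D.Adj x y) (hne : x ≠ y) : D.IsDipath x y [x, y] :=
  ⟨rfl, rfl, by simpa using hne, by simpa using h⟩

theorem IsDipath.start_mem {x y : V} {l : List V} (h : D.IsDipath x y l) : x ∈ l :=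
  List.mem_of_head? h.head_eq

theorem IsDipath.end_mem {x y : V} {l : List V} (h : D.IsDipath x y l) : y ∈ l :=
  List.mem_of_getLast? h.last_eq

theorem IsDipath.eq_cons {x y : V} {l : List V} (h : D.IsDipath x y l) : l = x :: l.tail :=
  (List.cons_head?_tail h.head_eq).symm

theorem IsDipath.start_notMem_tail {x y : V} {l : List V} (h : D.IsDipath x y l) : x ∉ l.tail := by
  have := h.nodup
  rw [h.eq_cons] at this
  exact (List.nodup_cons.mp this).1

theorem IsDipath.append {x y z : V} {l q : List V} (hl : D.IsDipath x y l) (hq : D.IsDipath y z q)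
    (h : ∀ v ∈ l, v ∈ q → v = y) : D.IsDipath x z (l ++ q.tail) := by
  have hqe := hq.eq_cons
  refine ⟨?_, ?_, ?_, ?_⟩
  · rw [hl.eq_cons]; rfl
  · have h1 := hq.last_eq
    rw [hqe, List.getLast?_cons] at h1
    rw [List.getLast?_append, hl.last_eq, ← h1]
    cases q.tail.getLast? <;> rfl
  · refine List.Nodup.append hl.nodup (hq.nodup.sublist (List.tail_sublist _)) ?_
    intro v hv hv'
    exact hq.start_notMem_tail (h v hv (List.mem_of_mem_tail hv') ▸ hv')
  · refine List.IsChain.append hl.chain hq.chain.tail ?_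
    intro u hu v hv
    rw [hl.last_eq, Option.mem_some_iff] at hu
    subst hu
    have := hq.chain
    rw [hqe, List.isChain_cons] at this
    exact this.1 v hv

theorem IsDipath.cons {x x' y : V} {l : List V} (h : D.Adj x x') (hl : D.IsDipath x' y l)
    (hx : x ∉ l) : D.IsDipath x y (x :: l) := by
  have hne : x ≠ x' := fun e => hx (e ▸ hl.start_mem)
  have := (isDipath_pair h hne).append hl (by
    intro v hv hv'
    rcases List.mem_cons.mp hv with rfl | hv
    · exact absurd hv' hx
    · simpa using hv)
  rwa [List.cons_append, List.cons_append, List.nil_append, ← hl.eq_cons] at this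

/-- Built backwards from `z`: a new vertex in `A` restarts the path, a vertex already on the path
cuts it down to the part from there on, and any other vertex is prepended. The last clause transfers
restrictions built into `r`, such as avoiding a set, to every vertex but the first. -/
theorem exists_isDipath_of_reflTransGen {r : V → V → Prop} (hr : ∀ u v, r u v → D.Adj u v)
    {x z : V} (h : Relation.ReflTransGen r x z) {A : Set V} (hz : z ∈ A) :
    ∃ y l, D.IsDipath x y l ∧ y ∈ A ∧ (∀ v ∈ l, v ∈ A → v = y) ∧
      ∀ v ∈ l, v = x ∨ ∃ u, r u v := by
  induction h using Relation.ReflTransGen.head_induction_on with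
  | refl => exact ⟨z, [z], isDipath_singleton z, hz, by simp, by simp⟩
  | @head x x' hxx _ ih =>
    obtain ⟨y, l, hl, hy, hA, hlr⟩ := ih
    have hlr' : ∀ v ∈ l, ∃ u, r u v := by
      intro v hv
      rcases hlr v hv with rfl | h
      · exact ⟨x, hxx⟩
      · exact h
    by_cases hxA : x ∈ A
    · exact ⟨x, [x], isDipath_singleton x, hxA, by simp, by simp⟩
    by_cases hxl : x ∈ l
    · obtain ⟨p, hp⟩ := List.mem_iff_getElem?.mp hxl
      have hlast := hl.last_eq
      rw [List.getLast?_eq_getElem?] at hlast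
      have hlt := (List.getElem?_eq_some_iff.mp hp).1
      have hsub : ∀ v ∈ (l.take (l.length - 1 + 1)).drop p, v ∈ l := fun v hv =>
        List.mem_of_mem_take (List.mem_of_mem_drop hv)
      exact ⟨y, _, hl.extract (by omega) hp hlast, hy, fun v hv => hA v (hsub v hv),
        fun v hv => Or.inr (hlr' v (hsub v hv))⟩
    · refine ⟨y, x :: l, hl.cons (hr _ _ hxx) hxl, hy, ?_, ?_⟩
      · intro v hv hvA
        rcases List.mem_cons.mp hv with rfl | hv
        · exact absurd hvA hxA
        · exact hA v hv hvA
      · intro v hv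
        rcases List.mem_cons.mp hv with rfl | hv
        · exact Or.inl rfl
        · exact Or.inr (hlr' v hv)

/-- Two vertices that reach a common vertex are the starting points of two dipaths with the same end
that are otherwise disjoint. -/
theorem exists_merging_isDipath {r : V → V → Prop} (hr : ∀ u v, r u v → D.Adj u v) {x x' z : V}
    (h : Relation.ReflTransGen r x z) (h' : Relation.ReflTransGen r x' z) :
    ∃ y q q', D.IsDipath x y q ∧ D.IsDipath x' y q' ∧ (∀ v ∈ q, v ∈ q' → v = y) ∧
      (∀ v ∈ q, v = x ∨ ∃ u, r u v) ∧ ∀ v ∈ q', v = x' ∨ ∃ u, r u v := by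
  obtain ⟨z', p, hp, hz', -, hpr⟩ := exists_isDipath_of_reflTransGen hr h (Set.mem_singleton z)
  obtain rfl : z' = z := hz'
  -- The second dipath stops as soon as it hits `p`; cutting `p` at that vertex gives the first.
  obtain ⟨y, q', hq', hy, hyp, hqr⟩ :=
    exists_isDipath_of_reflTransGen hr h' (A := {v | v ∈ p}) hp.end_mem
  obtain ⟨k, hk⟩ := List.mem_iff_getElem?.mp hy
  have hhead := hp.head_eq
  rw [List.head?_eq_getElem?] at hhead
  have hsub : ∀ v ∈ (p.take (k + 1)).drop 0, v ∈ p := fun v hv =>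
    List.mem_of_mem_take (List.mem_of_mem_drop hv)
  exact ⟨y, _, q', hp.extract (Nat.zero_le k) hhead hk, hq',
    fun v hv hv' => hyp v hv' (hsub v hv), fun v hv => hpr v (hsub v hv), hqr⟩

/-! ### Minimal sets with small out-boundary. -/

section Boundary

open Classical Finset

variable [Fintype V]

variable (D) in
/-- The out-neighbours of `v`. -/
noncomputable def outNbrs (v : V) : Finset V := {w | D.Adj v w}

@[simp]
theorem mem_outNbrs {v w : V} : w ∈ D.outNbrs v ↔ D.Adj v w := by simp [outNbrs]

theorem card_outNbrs (v : V) : #(D.outNbrs v) = D.outDegree v := by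
  rw [outDegree, ← Set.ncard_coe_finset]
  congr 1
  ext w
  simp

variable (D) in
/-- The out-neighbours of the set `X` outside `X`. -/
noncomputable def outBoundary (X : Finset V) : Finset V := {w | w ∉ X ∧ ∃ x ∈ X, D.Adj x w}

theorem mem_outBoundary {X : Finset V} {w : V} :
    w ∈ D.outBoundary X ↔ w ∉ X ∧ ∃ x ∈ X, D.Adj x w := by simp [outBoundary]

variable (D) in
-- The whole vertex set has empty out-boundary, so candidates exist; one of least cardinality is
-- minimal.
theorem exists_minimal_outBoundary [Nonempty V] (k : ℕ) :
    ∃ X : Finset V, X.Nonempty ∧ #(D.outBoundary X) ≤ k ∧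
      ∀ Y, Y ⊂ X → Y.Nonempty → k < #(D.outBoundary Y) := by
  have hne : ({X | X.Nonempty ∧ #(D.outBoundary X) ≤ k} : Finset (Finset V)).Nonempty := by
    exact ⟨univ, mem_filter.mpr ⟨mem_univ _, univ_nonempty, by simp [outBoundary]⟩⟩
  obtain ⟨X, hX, hmin⟩ := exists_min_image _ card hne
  simp only [mem_filter, mem_univ, true_and] at hX hmin
  refine ⟨X, hX.1, hX.2, fun Y hY hYne => ?_⟩
  by_contra hc
  exact absurd (hmin Y ⟨hYne, not_lt.mp hc⟩) (not_le.mpr (card_lt_card hY))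

/-- Let `R x` be the set reached from `x` inside `X` while avoiding `S`. If `R x` and `R x'` are
disjoint, both are proper subsets of `X`, so by minimality each has more than `k` boundary vertices.
Those outside `S` lie in the boundary of `X`, which has at most `k` vertices; as `2 * #S ≤ k`, the
two boundaries meet there. -/
theorem exists_common_reachable {k : ℕ} {X S : Finset V} (hX : #(D.outBoundary X) ≤ k)
    (hmin : ∀ Y, Y ⊂ X → Y.Nonempty → k < #(D.outBoundary Y)) (hS : 2 * #S ≤ k) {x x' : V}
    (hx : x ∈ X) (hx' : x' ∈ X) :
    ∃ z, Relation.ReflTransGen (fun u v => D.Adj u v ∧ v ∉ S) x z ∧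
      Relation.ReflTransGen (fun u v => D.Adj u v ∧ v ∉ S) x' z := by
  let r : V → V → Prop := fun u v => D.Adj u v ∧ v ∉ S ∧ v ∈ X
  let R : V → Finset V := fun x => {w ∈ X | Relation.ReflTransGen r x w}
  have hRr : ∀ x w, w ∈ R x → Relation.ReflTransGen (fun u v => D.Adj u v ∧ v ∉ S) x w :=
    fun x w hw => Relation.ReflTransGen.mono (r := r) (fun u v h => ⟨h.1, h.2.1⟩) _ _
      (mem_filter.mp hw).2
  have hself : ∀ x ∈ X, x ∈ R x := fun x hx => mem_filter.mpr ⟨hx, .refl⟩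
  by_cases hint : Disjoint (R x) (R x')
  swap
  · obtain ⟨z, hz, hz'⟩ := not_disjoint_iff.mp hint
    exact ⟨z, hRr _ _ hz, hRr _ _ hz'⟩
  -- A boundary vertex of `R x` that lies in `X` and not in `S` would itself have been reached.
  have hsub : ∀ x ∈ X, D.outBoundary (R x) \ S ⊆ D.outBoundary X := by
    intro x hx w hw
    rw [mem_sdiff, mem_outBoundary] at hw
    obtain ⟨⟨hwR, u, hu, huw⟩, hwS⟩ := hw
    obtain ⟨huX, hxu⟩ := mem_filter.mp hu
    refine mem_outBoundary.mpr ⟨fun hwX => hwR ?_, u, huX, huw⟩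
    exact mem_filter.mpr ⟨hwX, hxu.tail ⟨huw, hwS, hwX⟩⟩
  have hcard : ∀ x ∈ X, (∃ y ∈ X, y ∉ R x) → k + 1 - #S ≤ #(D.outBoundary (R x) \ S) := by
    rintro x hx ⟨y, hy, hyR⟩
    have h1 := hmin (R x) ((ssubset_iff_of_subset (filter_subset _ _)).mpr ⟨y, hy, hyR⟩)
      ⟨x, hself x hx⟩
    have h2 := le_card_sdiff S (D.outBoundary (R x))
    omega
  have h1 := hcard x hx ⟨x', hx', disjoint_right.mp hint (hself x' hx')⟩
  have h2 := hcard x' hx' ⟨x, hx, disjoint_left.mp hint (hself x hx)⟩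
  have hnd : ¬ Disjoint (D.outBoundary (R x) \ S) (D.outBoundary (R x') \ S) := by
    intro hd
    have h3 := card_le_card (union_subset (hsub x hx) (hsub x' hx'))
    rw [card_union_of_disjoint hd] at h3
    omega
  obtain ⟨z, hz, hz'⟩ := not_disjoint_iff.mp hnd
  have hreach : ∀ x, z ∈ D.outBoundary (R x) \ S →
      Relation.ReflTransGen (fun u v => D.Adj u v ∧ v ∉ S) x z := by
    intro x hz
    rw [mem_sdiff, mem_outBoundary] at hz
    obtain ⟨⟨-, u, hu, huz⟩, hzS⟩ := hz
    exact (hRr x u hu).tail ⟨huz, hzS⟩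
  exact ⟨z, hreach x hz, hreach x' hz'⟩

end Boundary

end Digraph

/-! ### Forks. -/

theorem Nat.exists_greatest_of_le {P : ℕ → Prop} {n N : ℕ} (hn : P n) (hN : ∀ m, P m → m ≤ N) :
    ∃ m, P m ∧ ∀ m', P m' → m' ≤ m := by
  classical
  exact ⟨Nat.findGreatest P N, Nat.findGreatest_spec (hN n hn) hn,
    fun m' hm' => Nat.le_findGreatest (hN m' hm') hm'⟩

/-- Two lists of vertices, meant as two dipaths that start at `root` and end at the tips. -/
structure Fork (V : Type*) where
  root : V
  tip : Bool → V
  leg : Bool → List V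

/-- The legs of `f` are dipaths of `D[X]` that meet only in the root. -/
structure Fork.IsIn {V : Type*} (D : Digraph V) (X : Finset V) (f : Fork V) : Prop where
  dipath : ∀ c, D.IsDipath f.root (f.tip c) (f.leg c)
  eq_root : ∀ v ∈ f.leg false, v ∈ f.leg true → v = f.root
  subset : ∀ c, ∀ v ∈ f.leg c, v ∈ X

section

open Classical Finset

/-- The vertices on the legs of a fork. -/
noncomputable def Fork.verts {V : Type*} (f : Fork V) : Finset V :=
  (f.leg false).toFinset ∪ (f.leg true).toFinset

namespace Fork

variable {V : Type*} {D : Digraph V} {X : Finset V} {f : Fork V}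

theorem mem_verts {v : V} : v ∈ f.verts ↔ ∃ c, v ∈ f.leg c := by
  simp [verts]

theorem mem_verts_of_mem {v : V} {c : Bool} (h : v ∈ f.leg c) : v ∈ f.verts :=
  mem_verts.mpr ⟨c, h⟩

theorem card_verts_le : #f.verts ≤ (f.leg false).length + (f.leg true).length :=
  (card_union_le _ _).trans (add_le_add (List.toFinset_card_le _) (List.toFinset_card_le _))

theorem IsIn.root_mem_verts (hf : f.IsIn D X) : f.root ∈ f.verts :=
  mem_verts_of_mem (hf.dipath false).start_mem

theorem IsIn.tip_mem_verts (hf : f.IsIn D X) (c : Bool) : f.tip c ∈ f.verts :=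
  mem_verts_of_mem (hf.dipath c).end_mem

theorem IsIn.eq_root_of_mem {v : V} {c c' : Bool} (hf : f.IsIn D X) (hc : c ≠ c')
    (h : v ∈ f.leg c) (h' : v ∈ f.leg c') : v = f.root := by
  cases c <;> cases c' <;> simp only [ne_eq, not_true_eq_false] at hc
  · exact hf.eq_root v h h'
  · exact hf.eq_root v h' h

theorem IsIn.mem_of_mem_verts {v : V} (hf : f.IsIn D X) (h : v ∈ f.verts) : v ∈ X := by
  obtain ⟨c, hc⟩ := mem_verts.mp h
  exact hf.subset c v hc

/-- Append the vertex `w` to the leg `c`. -/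
noncomputable def extend (f : Fork V) (c : Bool) (w : V) : Fork V where
  root := f.root
  tip := Function.update f.tip c w
  leg := Function.update f.leg c (f.leg c ++ [w])

theorem mem_leg_extend {c c' : Bool} {v w : V} :
    v ∈ (f.extend c w).leg c' ↔ v ∈ f.leg c' ∨ (c' = c ∧ v = w) := by
  by_cases h : c' = c
  · subst h; simp [extend]
  · simp [extend, h]

theorem verts_extend (c : Bool) (w : V) : (f.extend c w).verts = insert w f.verts := by
  ext v
  simp only [mem_verts, mem_leg_extend, mem_insert, exists_or]
  constructor
  · rintro (h | ⟨_, -, h⟩)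
    · exact Or.inr h
    · exact Or.inl h
  · rintro (h | h)
    · exact Or.inr ⟨c, rfl, h⟩
    · exact Or.inl h

theorem IsIn.extend {c : Bool} {w : V} (hf : f.IsIn D X) (hw : w ∈ X) (hwf : w ∉ f.verts)
    (hadj : D.Adj (f.tip c) w) : (f.extend c w).IsIn D X := by
  have hne : f.tip c ≠ w := fun h => hwf (h ▸ hf.tip_mem_verts c)
  refine ⟨fun c' => ?_, fun v hv hv' => ?_, fun c' v hv => ?_⟩
  · by_cases h : c' = c
    · subst h
      have := (hf.dipath c').append (Digraph.isDipath_pair hadj hne) (by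
        intro v hv hv'
        simp only [List.mem_cons, List.not_mem_nil, or_false] at hv'
        rcases hv' with rfl | rfl
        · rfl
        · exact absurd (mem_verts_of_mem hv) hwf)
      simpa [Fork.extend] using this
    · simpa [Fork.extend, h] using hf.dipath c'
  · rw [mem_leg_extend] at hv hv'
    rcases hv with hv | ⟨hc, rfl⟩ <;> rcases hv' with hv' | ⟨hc', hw'⟩
    · exact hf.eq_root v hv hv'
    · exact absurd (mem_verts_of_mem (hw' ▸ hv)) hwf
    · exact absurd (mem_verts_of_mem hv') hwf
    · rw [← hc'] at hc; cases hc
  · rw [mem_leg_extend] at hv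
    rcases hv with hv | ⟨-, rfl⟩
    · exact hf.subset c' v hv
    · exact hw

end Fork

/-! ### Peeling, ranks, and a fork family whose tips send many arcs back to it. -/

namespace Digraph

variable {V : Type*} [Fintype V] {D : Digraph V}

variable (D) in
/-- Starting from `Z`, discard repeatedly all vertices with less than `k` out-neighbours left. -/
noncomputable def peel (k : ℕ) (Z : Finset V) : ℕ → Finset V
  | 0 => Z
  | i + 1 => {z ∈ peel k Z i | k ≤ #(D.outNbrs z ∩ peel k Z i)}

theorem peel_antitone (k : ℕ) (Z : Finset V) : Antitone (D.peel k Z) :=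
  antitone_nat_of_succ_le fun _ => filter_subset _ _

/-- Greedy descent through the layers: a vertex of layer `i + 1` has `k` out-neighbours in layer
`i`, more than the forbidden set `A` can block. Each step adds one vertex to `A` and uses up one
layer, which preserves `#A + i ≤ k`. -/
theorem exists_isDipath_of_mem_peel {k : ℕ} {Z : Finset V} (i : ℕ) {z : V} {A : Finset V}
    (hz : z ∈ D.peel k Z i) (hzA : z ∈ A) (hA : #A + i ≤ k) :
    ∃ y l, D.IsDipath z y l ∧ l.length = i + 1 ∧ (∀ v ∈ l, v ∈ Z) ∧ ∀ v ∈ l, v ∈ A → v = z := by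
  induction i generalizing z A with
  | zero => exact ⟨z, [z], isDipath_singleton z, rfl, by simpa [peel] using hz, by simp⟩
  | succ i ih =>
    obtain ⟨hzi, hcard⟩ := mem_filter.mp hz
    have hlt : #A < #(D.outNbrs z ∩ D.peel k Z i) := by omega
    obtain ⟨w, hw, hwA⟩ := exists_mem_notMem_of_card_lt_card hlt
    rw [mem_inter, mem_outNbrs] at hw
    obtain ⟨y, l, hl, hlen, hlZ, hlA⟩ := ih hw.2 (mem_insert_self w A)
      (by rw [card_insert_of_notMem hwA]; omega)
    have hnot : ∀ v ∈ l, v ∉ A := by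
      intro v hv hvA
      obtain rfl := hlA v hv (mem_insert_of_mem hvA)
      exact hwA hvA
    refine ⟨y, z :: l, hl.cons hw.1 (fun h => hnot z h hzA), by simp [hlen], ?_, ?_⟩
    · intro v hv
      rcases List.mem_cons.mp hv with rfl | hv
      · exact peel_antitone k Z (Nat.zero_le i) hzi
      · exact hlZ v hv
    · intro v hv hvA
      rcases List.mem_cons.mp hv with rfl | hv
      · rfl
      · exact absurd hvA (hnot v hv)

theorem exists_fork_of_mem_peel {b k : ℕ} {Z : Finset V} (hk : 2 * b + 1 ≤ k) {z : V}
    (hz : z ∈ D.peel k Z b) : ∃ f : Fork V, f.IsIn D Z ∧ ∀ c, (f.leg c).length = b + 1 := by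
  obtain ⟨y, l, hl, hlen, hlZ, -⟩ := exists_isDipath_of_mem_peel b hz (mem_singleton_self z)
    (by rw [card_singleton]; omega)
  have hc := List.toFinset_card_le l
  -- The second leg treats the at most `b + 1` vertices of the first as forbidden; with `b` layers
  -- to descend this needs `k ≥ 2 * b + 1`.
  obtain ⟨y', l', hl', hlen', hlZ', hA⟩ := exists_isDipath_of_mem_peel b hz (A := l.toFinset)
    (List.mem_toFinset.mpr hl.start_mem) (by omega)
  refine ⟨⟨z, fun c => if c then y' else y, fun c => if c then l' else l⟩, ⟨?_, ?_, ?_⟩, ?_⟩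
  · rintro (_ | _) <;> simpa
  · intro v hv hv'
    exact hA v (by simpa using hv') (by simpa using hv)
  · rintro (_ | _) <;> simpa
  · rintro (_ | _) <;> simpa

/-- If there is no fork with legs of `b` arcs in `D[Z]`, the vertices of `Z` can be ranked by
`0, …, b - 1` such that each has few out-neighbours of at least its own rank. -/
theorem exists_rank {b k : ℕ} {Z : Finset V} (hk : 2 * b + 1 ≤ k)
    (hZ : ¬ ∃ f : Fork V, f.IsIn D Z ∧ ∀ c, (f.leg c).length = b + 1) :
    ∃ ρ : V → ℕ, (∀ z ∈ Z, ρ z < b) ∧ ∀ z ∈ Z, #{w ∈ Z | D.Adj z w ∧ ρ z ≤ ρ w} < k := by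
  -- The rank is the last layer, up to `b`, containing the vertex. Rank `b` would give a fork, and
  -- `k` out-neighbours of at least its own rank would let a vertex survive one more round.
  let ρ : V → ℕ := fun z => Nat.findGreatest (fun i => z ∈ D.peel k Z i) b
  have hρ : ∀ z ∈ Z, z ∈ D.peel k Z (ρ z) := fun z hz =>
    Nat.findGreatest_spec (P := fun i => z ∈ D.peel k Z i) (Nat.zero_le b) hz
  have hlt : ∀ z ∈ Z, ρ z < b := by
    intro z hz
    refine lt_of_le_of_ne (Nat.findGreatest_le b) fun h => hZ ?_
    exact exists_fork_of_mem_peel hk (h ▸ hρ z hz)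
  refine ⟨ρ, hlt, fun z hz => ?_⟩
  by_contra hc
  have hmem : z ∈ D.peel k Z (ρ z + 1) := by
    refine mem_filter.mpr ⟨hρ z hz, (not_lt.mp hc).trans (card_le_card fun w hw => ?_)⟩
    obtain ⟨hwZ, hzw, hle⟩ := mem_filter.mp hw
    exact mem_inter.mpr ⟨mem_outNbrs.mpr hzw, peel_antitone k Z hle (hρ w hwZ)⟩
  have := Nat.le_findGreatest (P := fun i => z ∈ D.peel k Z i) (hlt z hz) hmem
  exact absurd this (Nat.not_succ_le_self _)

/-- A digraph of large minimum out-degree contains disjoint forks, each of whose tips has many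
out-neighbours on the forks. -/
theorem exists_fork_family {b d : ℕ} {X : Finset V} (hX : X.Nonempty)
    (hdeg : ∀ x ∈ X, d + (2 * b + 1) ≤ #(D.outNbrs x ∩ X)) :
    ∃ m, 0 < m ∧ ∃ F : Fin m → Fork V, (∀ i, (F i).IsIn D X) ∧
      (∀ i c, b < ((F i).leg c).length ∧ ((F i).leg c).length ≤ 2 * b + 1) ∧
      (∀ i j, i ≠ j → Disjoint (F i).verts (F j).verts) ∧
      ∀ i c, d ≤ #(D.outNbrs ((F i).tip c) ∩ univ.biUnion fun i => (F i).verts) := by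
  -- A largest family of disjoint forks with legs of exactly `b` arcs; what remains of `X` then
  -- contains no such fork and can be ranked.
  let IsBase : (m : ℕ) → (Fin m → Fork V) → Prop := fun m F => (∀ i, (F i).IsIn D X) ∧
    (∀ i c, ((F i).leg c).length = b + 1) ∧ ∀ i j, i ≠ j → Disjoint (F i).verts (F j).verts
  obtain ⟨m, ⟨B, hBin, hBlen, hBdisj⟩, hmax⟩ :
      ∃ m, (∃ F, IsBase m F) ∧ ∀ m', (∃ F, IsBase m' F) → m' ≤ m := by
    refine Nat.exists_greatest_of_le (n := 0) (N := Fintype.card V)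
      ⟨fun i => i.elim0, fun i => i.elim0, fun i => i.elim0, fun i => i.elim0⟩ ?_
    rintro m ⟨F, hF, -, hdisj⟩
    have hinj : Function.Injective fun i => (F i).root := by
      intro i j (hij : (F i).root = (F j).root)
      by_contra hne
      exact disjoint_left.mp (hdisj i j hne) (hF i).root_mem_verts (hij ▸ (hF j).root_mem_verts)
    simpa using Fintype.card_le_of_injective _ hinj
  set Y : Finset V := univ.biUnion fun i => (B i).verts with hY
  have hBY : ∀ i, (B i).verts ⊆ Y := fun i => subset_biUnion_of_mem (fun i => (B i).verts)
    (mem_univ i)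
  have hno : ¬ ∃ f : Fork V, f.IsIn D (X \ Y) ∧ ∀ c, (f.leg c).length = b + 1 := by
    rintro ⟨f, hf, hlen⟩
    have hfB : ∀ i, Disjoint f.verts (B i).verts := fun i => disjoint_left.mpr fun v hv hv' =>
      (mem_sdiff.mp (hf.mem_of_mem_verts hv)).2 (hBY i hv')
    have := hmax (m + 1) ⟨Fin.cons f B, ?_, ?_, ?_⟩
    · omega
    · intro i
      refine Fin.cases ?_ (fun i => ?_) i
      · exact ⟨hf.dipath, hf.eq_root, fun c v hv => (mem_sdiff.mp (hf.subset c v hv)).1⟩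
      · exact hBin i
    · intro i
      refine Fin.cases ?_ (fun i => ?_) i
      · exact hlen
      · exact hBlen i
    · intro i j
      refine Fin.cases ?_ (fun i => ?_) i <;> refine Fin.cases ?_ (fun j => ?_) j
      · exact fun h => absurd rfl h
      · exact fun _ => hfB j
      · exact fun _ => (hfB i).symm
      · exact fun h => hBdisj i j fun e => h (congrArg Fin.succ e)
  obtain ⟨ρ, hρb, hρ⟩ := exists_rank le_rfl hno
  -- Otherwise all of `X` is ranked, and a vertex of least rank would have at most `2 * b`
  -- out-neighbours in `X`.
  have hm : 0 < m := by
    rcases Nat.eq_zero_or_pos m with rfl | h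
    · exfalso
      have hYe : X \ Y = X := by simp [hY]
      rw [hYe] at hρ
      obtain ⟨x, hx, hxmin⟩ := exists_min_image X ρ hX
      have h1 := hρ x hx
      have h2 : D.outNbrs x ∩ X ⊆ {w ∈ X | D.Adj x w ∧ ρ x ≤ ρ w} := by
        intro w hw
        rw [mem_inter, mem_outNbrs] at hw
        exact mem_filter.mpr ⟨hw.2, hw.1, hxmin w hw.2⟩
      have h3 := card_le_card h2
      have h4 := hdeg x hx
      omega
    · exact h
  -- Vertices of the base forks get rank `b`, above every vertex of `X \ Y`.
  let σ : V → ℕ := fun v => if v ∈ X \ Y then ρ v else b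
  -- Legs may grow only along strictly decreasing rank, since length plus rank of the tip stays at
  -- most `2 * b + 1`; for the base forks this is `(b + 1) + b`. Covering `Y` ensures that all
  -- vertices of `X` off the forks are ranked by `ρ`.
  let Good : (Fin m → Fork V) → Prop := fun F => (∀ i, (F i).IsIn D X) ∧
    (∀ i c, b < ((F i).leg c).length ∧ ((F i).leg c).length + σ ((F i).tip c) ≤ 2 * b + 1) ∧
    (∀ i j, i ≠ j → Disjoint (F i).verts (F j).verts) ∧
    Y ⊆ univ.biUnion fun i => (F i).verts
  let size : (Fin m → Fork V) → ℕ := fun F => ∑ i, ∑ c, ((F i).leg c).length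
  obtain ⟨N, ⟨F, hF, rfl⟩, hFmax⟩ :
      ∃ N, (∃ F, Good F ∧ size F = N) ∧ ∀ N', (∃ F, Good F ∧ size F = N') → N' ≤ N := by
    refine Nat.exists_greatest_of_le (n := size B)
      (N := ∑ i : Fin m, ∑ c : Bool, (2 * b + 1)) ⟨B, ⟨hBin, ?_, hBdisj, subset_rfl⟩, rfl⟩ ?_
    · intro i c
      have h1 := hBlen i c
      have h2 : (B i).tip c ∉ X \ Y := fun h =>
        (mem_sdiff.mp h).2 (hBY i ((hBin i).tip_mem_verts c))
      simp only [σ, if_neg h2]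
      omega
    · rintro _ ⟨F, hF, rfl⟩
      exact sum_le_sum fun i _ => sum_le_sum fun c _ => by
        have := (hF.2.1 i c).2
        omega
  obtain ⟨hFin, hFlen, hFdisj, hFY⟩ := hF
  refine ⟨m, hm, F, hFin, fun i c => ⟨(hFlen i c).1, ?_⟩, hFdisj, fun i c => ?_⟩
  · have := (hFlen i c).2
    omega
  set U := univ.biUnion fun i => (F i).verts with hU
  have hFU : ∀ i, (F i).verts ⊆ U := fun i => subset_biUnion_of_mem (fun i => (F i).verts)
    (mem_univ i)
  have htip := (hFin i).mem_of_mem_verts ((hFin i).tip_mem_verts c)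
  -- By maximality of total length: an unused out-neighbour of smaller rank could be appended to the
  -- leg.
  have hblocked : ∀ w ∈ X, w ∉ U → D.Adj ((F i).tip c) w → σ ((F i).tip c) ≤ σ w := by
    intro w hwX hwU hadj
    by_contra hlt
    have hw : ∀ j, w ∉ (F j).verts := fun j h => hwU (hFU j h)
    let F' := Function.update F i ((F i).extend c w)
    have hverts : ∀ j, (F j).verts ⊆ (F' j).verts := by
      intro j
      by_cases h : j = i
      · subst h
        simp only [F', Function.update_self, Fork.verts_extend]
        exact subset_insert _ _
      · simp [F', h]
    have hdisj : ∀ j, j ≠ i → Disjoint ((F i).extend c w).verts (F j).verts := by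
      intro j h
      rw [Fork.verts_extend]
      exact disjoint_insert_left.mpr ⟨hw j, hFdisj i j h.symm⟩
    have hgood : Good F' := by
      refine ⟨fun j => ?_, fun j c' => ?_, fun j j' hne => ?_, fun v hv => ?_⟩
      · by_cases h : j = i
        · subst h
          simpa [F'] using (hFin j).extend hwX (hw j) hadj
        · simpa [F', h] using hFin j
      · by_cases h : j = i
        · subst h
          by_cases hc : c' = c
          · subst hc
            have := hFlen j c'
            simp only [F', Function.update_self, Fork.extend, List.length_append,
              List.length_singleton]
            omega
          · simpa [F', Fork.extend, hc] using hFlen j c'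
        · simpa [F', h] using hFlen j c'
      · by_cases h : j = i
        · subst h
          simpa [F', hne.symm] using hdisj j' hne.symm
        · by_cases h' : j' = i
          · subst h'
            simpa [F', h] using (hdisj j h).symm
          · simpa [F', h, h'] using hFdisj j j' hne
      · obtain ⟨j, -, hj⟩ := mem_biUnion.mp (hFY hv)
        exact mem_biUnion.mpr ⟨j, mem_univ j, hverts j hj⟩
    have hsize : size F < size F' := by
      have hle : ∀ j c', ((F j).leg c').length ≤ ((F' j).leg c').length := by
        intro j c'
        by_cases h : j = i
        · subst h
          by_cases hc : c' = c
          · subst hc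
            simp [F', Fork.extend]
          · simp [F', Fork.extend, hc]
        · simp [F', h]
      refine sum_lt_sum (fun j _ => sum_le_sum fun c' _ => hle j c') ⟨i, mem_univ i, ?_⟩
      exact sum_lt_sum (fun c' _ => hle i c') ⟨c, mem_univ c, by simp [F', Fork.extend]⟩
    exact absurd (hFmax _ ⟨F', hgood, rfl⟩) (not_le.mpr hsize)
  -- Unused out-neighbours have at least the rank of the tip. For a tip in `X \ Y` there are at most
  -- `2 * b` of these; for any other tip, of rank `b`, there are none.
  have hfew : #((D.outNbrs ((F i).tip c) ∩ X) \ U) ≤ 2 * b := by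
    have hZ : ∀ w ∈ (D.outNbrs ((F i).tip c) ∩ X) \ U, w ∈ X \ Y ∧ D.Adj ((F i).tip c) w ∧
        σ ((F i).tip c) ≤ ρ w := by
      intro w hw
      rw [mem_sdiff, mem_inter, mem_outNbrs] at hw
      have hwZ : w ∈ X \ Y := mem_sdiff.mpr ⟨hw.1.2, fun h => hw.2 (hFY h)⟩
      have := hblocked w hw.1.2 hw.2 hw.1.1
      simp only [σ, if_pos hwZ] at this
      exact ⟨hwZ, hw.1.1, this⟩
    by_cases ht : (F i).tip c ∈ X \ Y
    · refine (card_le_card fun w hw => ?_).trans (Nat.le_of_lt_succ (hρ _ ht))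
      obtain ⟨h1, h2, h3⟩ := hZ w hw
      simp only [σ, if_pos ht] at h3
      exact mem_filter.mpr ⟨h1, h2, h3⟩
    · rw [eq_empty_of_forall_notMem (s := (D.outNbrs ((F i).tip c) ∩ X) \ U)]
      · simp
      intro w hw
      obtain ⟨h1, -, h3⟩ := hZ w hw
      have := hρb w h1
      simp only [σ, if_neg ht] at h3
      omega
  have h1 := hdeg _ htip
  have h2 : D.outNbrs ((F i).tip c) ∩ X ⊆
      (D.outNbrs ((F i).tip c) ∩ U) ∪ ((D.outNbrs ((F i).tip c) ∩ X) \ U) := by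
    intro w hw
    by_cases h : w ∈ U
    · exact mem_union_left _ (mem_inter.mpr ⟨(mem_inter.mp hw).1, h⟩)
    · exact mem_union_right _ (mem_sdiff.mpr ⟨hw, h⟩)
  have h3 := (card_le_card h2).trans (card_union_le _ _)
  omega

end Digraph

/-! ### Passing to a dense part of the family. -/

/-- A family of pairs of large sets over a small ground set has a subfamily that is rich at both
sides: the two sets of each remaining pair are still large, and each remaining point lies in many
of the remaining pairs. -/
theorem exists_rich_subfamily {ι V : Type*} [Fintype ι] [Fintype V] (N : ι → Bool → Finset V)
    {U : Finset V} {d K : ℕ} (hN : ∀ i c, N i c ⊆ U) (hd : ∀ i c, d ≤ #(N i c))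
    (h : K * (Fintype.card ι + #U) < d * Fintype.card ι) :
    ∃ (A : Finset ι) (T : Finset V), A.Nonempty ∧ (∀ i ∈ A, ∀ c, K < #(N i c ∩ T)) ∧
      ∀ t ∈ T, K < #{i ∈ A | ∃ c, t ∈ N i c} := by
  -- The minimum of the two sizes, rather than their sum, forces both sets of a pair to stay large.
  let μ : ι → Finset V → ℕ := fun i T => min #(N i false ∩ T) #(N i true ∩ T)
  let g : Finset ι → Finset V → ℕ := fun A T => ∑ i ∈ A, μ i T
  -- Among the `(A, T)` satisfying this density inequality one with `#A + #T` least is taken.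
  -- Deleting an index or a point lowers the left side by `K`, so each deletion must cost the right
  -- side more than `K`.
  have hne : ({p | K * (#p.1 + #p.2) < g p.1 p.2} : Finset (Finset ι × Finset V)).Nonempty := by
    refine ⟨(univ, U), mem_filter.mpr ⟨mem_univ _, ?_⟩⟩
    have : ∑ _i : ι, d ≤ g univ U := sum_le_sum fun i _ => by
      simp only [μ, inter_eq_left.mpr (hN i _)]
      exact le_min (hd i _) (hd i _)
    rw [sum_const, card_univ, smul_eq_mul] at this
    simp only [card_univ]
    linarith [mul_comm d (Fintype.card ι)]
  obtain ⟨⟨A, T⟩, hAT, hmin⟩ := exists_min_image _ (fun p => #p.1 + #p.2) hne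
  simp only [mem_filter, mem_univ, true_and, Prod.forall] at hAT hmin
  refine ⟨A, T, ?_, ?_, ?_⟩
  · rw [nonempty_iff_ne_empty]
    rintro rfl
    simp [g] at hAT
  · intro i hi
    have hμ : K < μ i T := by
      have h1 := hmin (A.erase i) T
      have h2 : g (A.erase i) T + μ i T = g A T := sum_erase_add A _ hi
      have h3 := card_erase_add_one hi
      by_contra hle
      have h4 : K * (#(A.erase i) + #T) + K = K * (#A + #T) := by rw [← h3]; ring
      have := h1 (by omega)
      omega
    rintro (_ | _)
    · exact lt_of_lt_of_le hμ (min_le_left _ _)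
    · exact lt_of_lt_of_le hμ (min_le_right _ _)
  · intro t ht
    have h1 := hmin A (T.erase t)
    have h3 := card_erase_add_one ht
    have hstep : ∀ i, μ i T ≤ μ i (T.erase t) + if ∃ c, t ∈ N i c then 1 else 0 := by
      intro i
      have he : ∀ c, #(N i c ∩ T) ≤ #(N i c ∩ T.erase t) + if ∃ c, t ∈ N i c then 1 else 0 := by
        intro c
        rw [inter_erase]
        by_cases htN : ∃ c, t ∈ N i c
        · rw [if_pos htN]
          have := pred_card_le_card_erase (s := N i c ∩ T) (a := t)
          omega
        · rw [erase_eq_of_notMem fun h => htN ⟨c, (mem_inter.mp h).1⟩]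
          omega
      have := he false
      have := he true
      simp only [μ]
      omega
    have h2 : g A T ≤ g A (T.erase t) + #{i ∈ A | ∃ c, t ∈ N i c} := by
      rw [card_filter, ← sum_add_distrib]
      exact sum_le_sum fun i _ => hstep i
    by_contra hle
    have h4 : K * (#A + #(T.erase t)) + K = K * (#A + #T) := by rw [← h3]; ring
    have := h1 (by omega)
    omega

end

/-! ### Chains of forks and their closure to a cycle. -/

section

open Classical Finset

namespace Fork

variable {V : Type*} {D : Digraph V} {X : Finset V} {f : Fork V}

/-- The same fork with its legs interchanged if `o = false`. -/
def relabel (f : Fork V) (o : Bool) : Fork V where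
  root := f.root
  tip c := f.tip (c == o)
  leg c := f.leg (c == o)

theorem verts_relabel (o : Bool) : (f.relabel o).verts = f.verts := by
  cases o <;> simp [verts, relabel, union_comm]

theorem IsIn.relabel (hf : f.IsIn D X) (o : Bool) : (f.relabel o).IsIn D X where
  dipath c := hf.dipath _
  eq_root v hv hv' := hf.eq_root_of_mem (by cases o <;> simp) hv hv'
  subset c := hf.subset _

theorem IsIn.tip_ne_root (hf : f.IsIn D X) {c : Bool} (h : 1 < (f.leg c).length) :
    f.tip c ≠ f.root := by
  intro he
  have h1 := (hf.dipath c).head_eq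
  have h2 := (hf.dipath c).last_eq
  rw [List.head?_eq_getElem?] at h1
  rw [List.getLast?_eq_getElem?, he] at h2
  have := (hf.dipath c).nodup.eq_of_getElem?_eq_some h1 h2
  omega

end Fork

/-- Greedily, disjoint forks are lined up with new vertices joining consecutive ones. -/
theorem exists_fork_chain {ι V : Type*} [Fintype ι] [Fintype V] {F : ι → Fork V} {M K : ℕ}
    {N : ι → Bool → Finset V} {A : Finset ι} {T : Finset V}
    (hdisj : ∀ i j, i ≠ j → Disjoint (F i).verts (F j).verts) (hM : ∀ i, #(F i).verts ≤ M)
    (hN : ∀ i c, ∀ t ∈ N i c, t ∉ (F i).verts) (hA : A.Nonempty)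
    (hAT : ∀ i ∈ A, ∀ c, K < #(N i c ∩ T)) (hTA : ∀ t ∈ T, K < #{i ∈ A | ∃ c, t ∈ N i c})
    (k : ℕ) (hk : k * (M + 2) ≤ K) :
    ∃ (s : ℕ → ι) (o : ℕ → Bool) (u : ℕ → V), (∀ j ≤ k, s j ∈ A) ∧
      (∀ i ≤ k, ∀ j ≤ k, s i = s j → i = j) ∧
      (∀ j < k, u j ∈ N (s j) (o j) ∧ u j ∈ N (s (j + 1)) (!o (j + 1))) ∧
      (∀ j < k, ∀ i ≤ k, u j ∉ (F (s i)).verts) ∧ ∀ i < k, ∀ j < k, u i = u j → i = j := by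
  induction k with
  | zero =>
    obtain ⟨i, hi⟩ := hA
    obtain ⟨v, -⟩ := card_pos.mp ((Nat.zero_le K).trans_lt (hAT i hi true))
    exact ⟨fun _ => i, fun _ => true, fun _ => v, fun _ _ => hi, by omega, by omega, by omega,
      by omega⟩
  | succ k ih =>
    obtain ⟨s, o, u, hsA, hs, hu, huF, huinj⟩ := ih (by nlinarith)
    -- The new joining vertex must avoid the forks of the chain and the earlier joining vertices: at
    -- most `(k + 1) * M + k` vertices.
    let bad : Finset V := ((range (k + 1)).biUnion fun j => (F (s j)).verts) ∪ (range k).image u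
    have hbad : #bad < #(N (s k) (o k) ∩ T) := by
      have h1 : #((range (k + 1)).biUnion fun j => (F (s j)).verts) ≤ (k + 1) * M := by
        simpa using card_biUnion_le_card_mul (range (k + 1)) _ M fun j _ => hM (s j)
      have h2 : #((range k).image u) ≤ k := by simpa using card_image_le (s := range k) (f := u)
      have h3 := hAT (s k) (hsA k le_rfl) (o k)
      have h4 := card_union_le ((range (k + 1)).biUnion fun j => (F (s j)).verts)
        ((range k).image u)
      have h5 : (k + 1) * (M + 2) = (k + 1) * M + 2 * (k + 1) := by ring
      change #bad ≤ _ at h4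
      omega
    obtain ⟨t, ht, htbad⟩ := exists_mem_notMem_of_card_lt_card hbad
    obtain ⟨htN, htT⟩ := mem_inter.mp ht
    have htF : ∀ j ≤ k, t ∉ (F (s j)).verts := fun j hj h =>
      htbad (mem_union_left _ (mem_biUnion.mpr ⟨j, mem_range.mpr (by omega), h⟩))
    have htu : ∀ j < k, t ≠ u j := fun j hj h =>
      htbad (mem_union_right _ (mem_image.mpr ⟨j, mem_range.mpr hj, h.symm⟩))
    -- The new fork must be unused and free of earlier joining vertices. Each of those lies on at
    -- most one fork, so at most `2 * k + 1` indices are excluded; the newest vertex `t` is off the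
    -- new fork by `hN`.
    let bad' : Finset ι := (range (k + 1)).image s ∪
      (range k).biUnion fun j => {i | u j ∈ (F i).verts}
    have hbad' : #bad' < #{i ∈ A | ∃ c, t ∈ N i c} := by
      have h1 : #((range (k + 1)).image s) ≤ k + 1 := by
        simpa using card_image_le (s := range (k + 1)) (f := s)
      have h2 : #((range k).biUnion fun j => ({i | u j ∈ (F i).verts} : Finset ι)) ≤ k * 1 := by
        have := card_biUnion_le_card_mul (range k)
          (fun j => ({i | u j ∈ (F i).verts} : Finset ι)) 1 (fun j _ => by
            refine card_le_one.mpr fun i hi i' hi' => ?_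
            by_contra hne
            exact disjoint_left.mp (hdisj i i' hne) (mem_filter.mp hi).2 (mem_filter.mp hi').2)
        simpa using this
      have h3 := hTA t htT
      have h4 := card_union_le ((range (k + 1)).image s)
        ((range k).biUnion fun j => ({i | u j ∈ (F i).verts} : Finset ι))
      have h5 : (k + 1) * (M + 2) = (k + 1) * M + 2 * (k + 1) := by ring
      change #bad' ≤ _ at h4
      omega
    obtain ⟨i', hi', hibad⟩ := exists_mem_notMem_of_card_lt_card hbad'
    obtain ⟨hi'A, c, hc⟩ := mem_filter.mp hi'
    have his : ∀ j ≤ k, s j ≠ i' := fun j hj h =>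
      hibad (mem_union_left _ (mem_image.mpr ⟨j, mem_range.mpr (by omega), h⟩))
    have hiu : ∀ j < k, u j ∉ (F i').verts := fun j hj h =>
      hibad (mem_union_right _ (mem_biUnion.mpr
        ⟨j, mem_range.mpr hj, mem_filter.mpr ⟨mem_univ _, h⟩⟩))
    have hs' : ∀ j ≤ k, Function.update s (k + 1) i' j = s j := fun j hj =>
      Function.update_of_ne (by omega) _ _
    have hu' : ∀ j < k, Function.update u k t j = u j := fun j hj =>
      Function.update_of_ne (by omega) _ _
    have ho' : ∀ j ≤ k, Function.update o (k + 1) (!c) j = o j := fun j hj =>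
      Function.update_of_ne (by omega) _ _
    -- `o` marks the outgoing tip. The new fork is attached at tip `c`, so it continues at `!c`.
    refine ⟨Function.update s (k + 1) i', Function.update o (k + 1) (!c), Function.update u k t,
      fun j hj => ?_, fun i hi j hj => ?_, fun j hj => ?_, fun j hj i hi => ?_,
      fun i hi j hj => ?_⟩
    · rcases Nat.le_succ_iff.mp hj with h | rfl
      · rw [hs' j h]; exact hsA j h
      · simpa using hi'A
    · rcases Nat.le_succ_iff.mp hi with h | rfl <;> rcases Nat.le_succ_iff.mp hj with h' | rfl
      · rw [hs' i h, hs' j h']; exact hs i h j h'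
      · rw [hs' i h, Function.update_self]; exact fun e => absurd e (his i h)
      · rw [hs' j h', Function.update_self]; exact fun e => absurd e.symm (his j h')
      · exact fun _ => rfl
    · rcases Nat.lt_succ_iff_lt_or_eq.mp hj with h | rfl
      · rw [hu' j h, hs' j h.le, hs' (j + 1) h, ho' j h.le, ho' (j + 1) h]
        exact hu j h
      · rw [hs' j le_rfl, ho' j le_rfl]
        simpa using ⟨htN, hc⟩
    · rcases Nat.lt_succ_iff_lt_or_eq.mp hj with h | rfl <;>
        rcases Nat.le_succ_iff.mp hi with h' | rfl
      · rw [hu' j h, hs' i h']; exact huF j h i h'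
      · rw [hu' j h, Function.update_self]; exact hiu j h
      · rw [Function.update_self, hs' i h']; exact htF i h'
      · simpa using hN i' c t hc
    · rcases Nat.lt_succ_iff_lt_or_eq.mp hi with h | rfl <;>
        rcases Nat.lt_succ_iff_lt_or_eq.mp hj with h' | rfl
      · rw [hu' i h, hu' j h']; exact huinj i h j h'
      · rw [hu' i h, Function.update_self]; exact fun e => absurd e.symm (htu i h)
      · rw [hu' j h', Function.update_self]; exact fun e => absurd e (htu j h')
      · exact fun _ => rfl

/-- A chain of `k + 1` forks closes up to a subdivision of `C_{k+1,b}` along two dipaths from its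
free tips to a common end that avoid the rest of the chain. -/
theorem Digraph.containsSubdivision_of_fork_chain {V : Type*} {D : Digraph V} {X : Finset V}
    {b k : ℕ} (hb : 1 ≤ b) {G : ℕ → Fork V} {u : ℕ → V} {y : V} {q q' : List V}
    (hG : ∀ i ≤ k, (G i).IsIn D X) (hlen : ∀ i ≤ k, ∀ c, b < ((G i).leg c).length)
    (hdisj : ∀ i ≤ k, ∀ j ≤ k, i ≠ j → Disjoint (G i).verts (G j).verts)
    (hadj : ∀ j < k, D.Adj ((G j).tip true) (u j) ∧ D.Adj ((G (j + 1)).tip false) (u j))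
    (huG : ∀ j < k, ∀ i ≤ k, u j ∉ (G i).verts) (hu : ∀ i < k, ∀ j < k, u i = u j → i = j)
    (hq : D.IsDipath ((G 0).tip false) y q) (hq' : D.IsDipath ((G k).tip true) y q')
    (hqq' : ∀ v ∈ q, v ∈ q' → v = y)
    (hfree : ∀ v, v ∈ q ∨ v ∈ q' → v = (G 0).tip false ∨ v = (G k).tip true ∨
      (∀ i ≤ k, v ∉ (G i).verts) ∧ ∀ j < k, v ≠ u j) :
    D.ContainsSubdivision (orientedCycle (k + 1) b) := by
  have hval : ∀ i : ZMod (k + 1), i.val ≤ k := fun i => Nat.le_of_lt_succ (ZMod.val_lt i)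
  -- Sink `0` is the common end `y` of the closing dipaths; sink `i ≠ 0` is the vertex joining forks
  -- `i - 1` and `i`. `Q i c` continues a leg from its tip to its sink: a closing dipath at the two
  -- free tips, a single arc elsewhere.
  let nx : ZMod (k + 1) → Bool → ZMod (k + 1) := fun i c => if c then i + 1 else i
  let T : ZMod (k + 1) → V := fun i => if i = 0 then y else u (i.val - 1)
  let Q : ZMod (k + 1) → Bool → List V := fun i c =>
    if nx i c = 0 then (if c then q' else q) else [(G i.val).tip c, T (nx i c)]
  have hT0 : T 0 = y := if_pos rfl
  have hT : ∀ i, i ≠ 0 → ∃ j < k, i.val = j + 1 ∧ T i = u j := by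
    intro i hi
    have h1 := hval i
    have h2 : i.val ≠ 0 := fun h => hi ((ZMod.val_eq_zero i).mp h)
    exact ⟨i.val - 1, by omega, by omega, if_neg hi⟩
  have hmem_eq : ∀ {v : V} {i j : ℕ}, i ≤ k → j ≤ k → v ∈ (G i).verts → v ∈ (G j).verts →
      i = j := by
    intro v i j hi hj h1 h2
    by_contra hne
    exact disjoint_left.mp (hdisj i hi j hj hne) h1 h2
  have hlast : ∀ i : ZMod (k + 1), i + 1 = 0 ↔ i.val = k := by
    intro i
    have h1 : i + 1 = ((i.val + 1 : ℕ) : ZMod (k + 1)) := by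
      rw [Nat.cast_add, ZMod.natCast_zmod_val, Nat.cast_one]
    rw [h1, ZMod.natCast_eq_zero_iff]
    have h2 := hval i
    constructor
    · intro h
      have := Nat.le_of_dvd (by omega) h
      omega
    · intro h
      rw [h]
  have hnext : ∀ i : ZMod (k + 1), i + 1 ≠ 0 → (i + 1).val = i.val + 1 := by
    intro i hi
    have h1 : i + 1 = ((i.val + 1 : ℕ) : ZMod (k + 1)) := by
      rw [Nat.cast_add, ZMod.natCast_zmod_val, Nat.cast_one]
    have h2 := hval i
    have h3 : i.val ≠ k := fun h => hi ((hlast i).mpr h)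
    rw [h1, ZMod.val_natCast, Nat.mod_eq_of_lt (by omega)]
  have hy : y = (G 0).tip false ∨ y = (G k).tip true ∨
      (∀ i ≤ k, y ∉ (G i).verts) ∧ ∀ j < k, y ≠ u j := hfree y (Or.inl hq.end_mem)
  have hyu : ∀ j < k, y ≠ u j := by
    intro j hj h
    rcases hy with h' | h' | h'
    · exact huG j hj 0 (by omega) (h ▸ h' ▸ (hG 0 (by omega)).tip_mem_verts false)
    · exact huG j hj k le_rfl (h ▸ h' ▸ (hG k le_rfl).tip_mem_verts true)
    · exact h'.2 j hj h
  have hTinj : Function.Injective T := by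
    intro i j hij
    by_cases hi : i = 0 <;> by_cases hj : j = 0
    · rw [hi, hj]
    · obtain ⟨l, hl, -, hl'⟩ := hT j hj
      rw [hi, hT0, hl'] at hij
      exact absurd hij (hyu l hl)
    · obtain ⟨l, hl, -, hl'⟩ := hT i hi
      rw [hj, hT0, hl'] at hij
      exact absurd hij.symm (hyu l hl)
    · obtain ⟨l, hl, hil, hl'⟩ := hT i hi
      obtain ⟨p, hp, hjp, hp'⟩ := hT j hj
      rw [hl', hp'] at hij
      have := hu l hl p hp hij
      exact ZMod.val_injective _ (by omega)
  have htip : ∀ i ≤ k, ∀ c, (G i).tip c ≠ (G i).root := fun i hi c =>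
    (hG i hi).tip_ne_root ((hlen i hi c).trans_le' hb)
  have hleg : ∀ {i j : ℕ} {c c' : Bool}, i ≤ k → j ≤ k → (G i).tip c ∈ (G j).leg c' →
      i = j ∧ c = c' := by
    intro i j c c' hi hj h
    obtain rfl := hmem_eq hi hj ((hG i hi).tip_mem_verts c) (Fork.mem_verts_of_mem h)
    refine ⟨rfl, ?_⟩
    by_contra hne
    exact htip i hi c ((hG i hi).eq_root_of_mem hne ((hG i hi).dipath c).end_mem h)
  -- A closing dipath may be trivial, making `y` a free tip. This is the only way for a sink to lie
  -- on a leg, and it is then the end of that leg.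
  have hTleg : ∀ i' i c, T i' ∈ (G i.val).leg c →
      i' = 0 ∧ nx i c = 0 ∧ T i' = (G i.val).tip c := by
    intro i' i c h
    by_cases hi' : i' = 0
    · subst hi'
      rw [hT0] at h ⊢
      rcases hy with h' | h' | h'
      · rw [h'] at h ⊢
        obtain ⟨h1, rfl⟩ := hleg (Nat.zero_le k) (hval i) h
        exact ⟨rfl, (ZMod.val_eq_zero i).mp h1.symm, by rw [← h1]⟩
      · rw [h'] at h ⊢
        obtain ⟨h1, rfl⟩ := hleg le_rfl (hval i) h
        exact ⟨rfl, (hlast i).mpr h1.symm, by rw [← h1]⟩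
      · exact absurd (Fork.mem_verts_of_mem h) (h'.1 _ (hval i))
    · obtain ⟨j, hj, -, hj'⟩ := hT i' hi'
      rw [hj'] at h
      exact absurd (Fork.mem_verts_of_mem h) (huG j hj _ (hval i))
  have hQpath : ∀ i c, D.IsDipath ((G i.val).tip c) (T (nx i c)) (Q i c) := by
    intro i c
    by_cases h0 : nx i c = 0
    · simp only [Q, if_pos h0, h0, hT0]
      cases c with
      | false =>
        obtain rfl : i = 0 := h0
        simpa using hq
      | true =>
        rw [(hlast i).mp h0]
        simpa using hq'
    · simp only [Q, if_neg h0]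
      obtain ⟨j, hj, hj1, hj2⟩ := hT _ h0
      have hA : D.Adj ((G i.val).tip c) (u j) := by
        cases c with
        | false =>
          have h1 : i.val = j + 1 := hj1
          rw [h1]
          exact (hadj j hj).2
        | true =>
          have h1 : i.val = j := by
            have := hnext i h0
            have h2 : (i + 1).val = j + 1 := hj1
            omega
          rw [h1]
          exact (hadj j hj).1
      refine isDipath_pair (hj2 ▸ hA) fun h => huG j hj _ (hval i) ?_
      rw [← hj2, ← h]
      exact (hG _ (hval i)).tip_mem_verts c
  have hQ : ∀ i c, ∀ v ∈ Q i c, v = (G i.val).tip c ∨ v = T (nx i c) ∨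
      nx i c = 0 ∧ (∀ i ≤ k, v ∉ (G i).verts) ∧ ∀ j < k, v ≠ u j := by
    intro i c v hv
    by_cases h0 : nx i c = 0
    · simp only [Q, if_pos h0] at hv
      rw [h0, hT0]
      cases c with
      | false =>
        obtain rfl : i = 0 := h0
        have hv : v ∈ q := by simpa using hv
        rcases hfree v (Or.inl hv) with h | h | h
        · exact Or.inl (by simpa using h)
        · exact Or.inr (Or.inl (hqq' v hv (h ▸ hq'.start_mem)))
        · exact Or.inr (Or.inr ⟨rfl, h⟩)
      | true =>
        have hv : v ∈ q' := by simpa using hv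
        rcases hfree v (Or.inr hv) with h | h | h
        · exact Or.inr (Or.inl (hqq' v (h ▸ hq.start_mem) hv))
        · exact Or.inl (by rwa [(hlast i).mp h0])
        · exact Or.inr (Or.inr ⟨rfl, h⟩)
    · simp only [Q, if_neg h0, List.mem_cons, List.not_mem_nil, or_false] at hv
      tauto
  have hQtail : ∀ i c, ∀ v ∈ (Q i c).tail, v = T (nx i c) ∨
      nx i c = 0 ∧ (∀ i ≤ k, v ∉ (G i).verts) ∧ ∀ j < k, v ≠ u j := by
    intro i c v hv
    rcases hQ i c v (List.mem_of_mem_tail hv) with rfl | h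
    · exact absurd hv (hQpath i c).start_notMem_tail
    · exact h
  have hroot : ∀ i' i : ZMod (k + 1), (G i'.val).root ≠ T i := by
    intro i' i h
    have hmem := (hG _ (hval i')).root_mem_verts
    obtain ⟨c, hc⟩ := Fork.mem_verts.mp hmem
    rw [h] at hc
    exact htip _ (hval i') c ((hTleg i i' c hc).2.2.symm.trans h.symm)
  refine containsSubdivision_orientedCycle_of_blocks hb (fun i => (G i.val).root) T
    (fun i c => (G i.val).leg c ++ (Q i c).tail) ?_ ?_ ?_ ?_ ?_
  · intro i c
    refine ((hG _ (hval i)).dipath c).append (hQpath i c) fun v hv hv' => ?_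
    rcases hQ i c v hv' with h | rfl | h
    · exact h
    · exact (hTleg _ i c hv).2.2
    · exact absurd (Fork.mem_verts_of_mem hv) (h.2.1 _ (hval i))
  · intro i c
    have := hlen _ (hval i) c
    simp only [List.length_append]
    omega
  · intro i' i c h
    have hmem := (hG _ (hval i')).root_mem_verts
    rcases List.mem_append.mp h with h | h
    · exact ZMod.val_injective _ (hmem_eq (hval i') (hval i) hmem (Fork.mem_verts_of_mem h))
    · rcases hQtail i c _ h with h | h
      · exact absurd h (hroot i' _)
      · exact absurd hmem (h.2.1 _ (hval i'))
  · intro i' i c h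
    rcases List.mem_append.mp h with h | h
    · obtain ⟨h1, h2, -⟩ := hTleg i' i c h
      exact h1.trans h2.symm
    · rcases hQtail i c _ h with h | ⟨h0, -, h2⟩
      · exact hTinj h
      · by_contra hne
        have hi' : i' ≠ 0 := fun e => hne (e.trans h0.symm)
        obtain ⟨j, hj, -, hj'⟩ := hT i' hi'
        exact h2 j hj hj'
  · intro i c i' c' hne v hv hv'
    rcases List.mem_append.mp hv with hv | hv <;> rcases List.mem_append.mp hv' with hv' | hv'
    · have hii := ZMod.val_injective _ (hmem_eq (hval i) (hval i') (Fork.mem_verts_of_mem hv)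
        (Fork.mem_verts_of_mem hv'))
      subst hii
      exact Or.inl ⟨i, (hG _ (hval i)).eq_root_of_mem (fun e => hne (by rw [e])) hv hv'⟩
    · rcases hQtail i' c' v hv' with h | h
      · exact Or.inr ⟨_, h⟩
      · exact absurd (Fork.mem_verts_of_mem hv) (h.2.1 _ (hval i))
    · rcases hQtail i c v hv with h | h
      · exact Or.inr ⟨_, h⟩
      · exact absurd (Fork.mem_verts_of_mem hv') (h.2.1 _ (hval i'))
    · rcases hQtail i c v hv with h | ⟨h0, -⟩
      · exact Or.inr ⟨_, h⟩
      rcases hQtail i' c' v hv' with h | ⟨h0', -⟩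
      · exact Or.inr ⟨_, h⟩
      -- Both continuations are closing dipaths, and the blocks differ, so one is `q` and the other
      -- `q'`; they meet only in `y`.
      refine Or.inr ⟨0, ?_⟩
      have hv := List.mem_of_mem_tail hv
      have hv' := List.mem_of_mem_tail hv'
      simp only [Q, if_pos h0] at hv
      simp only [Q, if_pos h0'] at hv'
      rw [hT0]
      cases c <;> cases c'
      · exact absurd (congrArg (·, false) (h0.trans h0'.symm : i = i')) hne
      · exact hqq' v (by simpa using hv) (by simpa using hv')
      · exact hqq' v (by simpa using hv') (by simpa using hv)
      · exact absurd (congrArg (·, true)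
          (add_right_cancel (h0.trans h0'.symm : i + 1 = i' + 1))) hne

/-! ### Choice of parameters and conclusion. -/

/-- Minimum out-degree of order `a * b ^ 2` forces a subdivision of `C_{a,b}`, for any girth. -/
theorem Digraph.containsSubdivision_orientedCycle_of_le_outDegree {V : Type*} [Finite V]
    [Nonempty V] {D : Digraph V} {a b : ℕ} (ha : 1 ≤ a) (hb : 1 ≤ b)
    (hD : ∀ v, 100 * a * b ^ 2 ≤ D.outDegree v) :
    D.ContainsSubdivision (orientedCycle a b) := by
  have := Fintype.ofFinite V
  obtain ⟨k, rfl⟩ : ∃ k, a = k + 1 := ⟨a - 1, by omega⟩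
  -- `M` bounds the vertices of a fork with two legs of at most `2 * b + 1` vertices, `K` is the
  -- richness that suffices for the greedy chain, and `e` bounds the vertices of the chain with its
  -- joining vertices. The boundary bound `2 * e` lets closing dipaths avoid that many vertices.
  set M := 4 * b + 2 with hM
  set K := (k + 1) * (M + 2) with hK
  set e := (k + 1) * (M + 1) with he
  obtain ⟨X, hXne, hX, hXmin⟩ := D.exists_minimal_outBoundary (2 * e)
  have harith : K * (M + 1) + 1 + M + (2 * b + 1) + 2 * e ≤ 100 * (k + 1) * b ^ 2 := by
    obtain ⟨c, rfl⟩ : ∃ c, b = c + 1 := ⟨b - 1, by omega⟩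
    rw [hK, he, hM]
    ring_nf
    nlinarith [Nat.zero_le (k * c), Nat.zero_le (k * c ^ 2), Nat.zero_le c, Nat.zero_le k,
      Nat.zero_le (c ^ 2)]
  have hdeg : ∀ x ∈ X, (K * (M + 1) + 1 + M) + (2 * b + 1) ≤ #(D.outNbrs x ∩ X) := by
    intro x hx
    have h1 : D.outNbrs x ⊆ (D.outNbrs x ∩ X) ∪ D.outBoundary X := by
      intro w hw
      by_cases h : w ∈ X
      · exact mem_union_left _ (mem_inter.mpr ⟨hw, h⟩)
      · exact mem_union_right _ (mem_outBoundary.mpr ⟨h, x, hx, mem_outNbrs.mp hw⟩)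
    have h2 := (card_le_card h1).trans (card_union_le _ _)
    have h3 := hD x
    rw [← card_outNbrs] at h3
    omega
  obtain ⟨m, hm, F, hF, hFlen, hFdisj, hFd⟩ := exists_fork_family hXne hdeg
  set U := univ.biUnion fun i => (F i).verts with hU
  have hFM : ∀ i, #(F i).verts ≤ M := by
    intro i
    have h1 := (F i).card_verts_le
    have h2 := (hFlen i false).2
    have h3 := (hFlen i true).2
    omega
  -- Dropping the fork's own vertices costs at most `M` and keeps joining vertices off the forks
  -- they join.
  let N : Fin m → Bool → Finset V := fun i c => (D.outNbrs ((F i).tip c) ∩ U) \ (F i).verts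
  have hNadj : ∀ i c, ∀ t ∈ N i c, D.Adj ((F i).tip c) t := fun i c t ht =>
    mem_outNbrs.mp (mem_inter.mp (mem_sdiff.mp ht).1).1
  obtain ⟨A, T, hA, hAT, hTA⟩ := exists_rich_subfamily N (U := U) (d := K * (M + 1) + 1) (K := K)
    (fun i c => sdiff_subset.trans inter_subset_right)
    (fun i c => by
      have h1 := le_card_sdiff (F i).verts (D.outNbrs ((F i).tip c) ∩ U)
      have h2 := hFd i c
      have h3 := hFM i
      change _ ≤ #(N i c) at h1
      omega)
    (by
      have hUc : #U ≤ m * M := by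
        simpa using card_biUnion_le_card_mul univ (fun i => (F i).verts) M fun i _ => hFM i
      rw [Fintype.card_fin]
      -- The density hypothesis: with at most `M` vertices of `U` per fork, degree `K * (M + 1) + 1`
      -- is enough.
      calc K * (m + #U) ≤ K * (m + m * M) := by gcongr
        _ < (K * (M + 1) + 1) * m := by
          have : (K * (M + 1) + 1) * m = K * (m + m * M) + m := by ring
          omega)
  obtain ⟨s, o, u, -, hs, hu, huF, huinj⟩ := exists_fork_chain hFdisj hFM
    (fun i c t ht => (mem_sdiff.mp ht).2) hA hAT hTA k
    (by rw [hK]; exact Nat.mul_le_mul_right _ (Nat.le_succ k))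
  let G : ℕ → Fork V := fun j => (F (s j)).relabel (o j)
  have hGv : ∀ j, (G j).verts = (F (s j)).verts := fun j => Fork.verts_relabel (o j)
  have hG : ∀ j, (G j).IsIn D X := fun j => (hF (s j)).relabel (o j)
  let W : Finset V := ((range (k + 1)).biUnion fun j => (G j).verts) ∪ (range k).image u
  have hWc : #W ≤ e := by
    have h1 : #((range (k + 1)).biUnion fun j => (G j).verts) ≤ (k + 1) * M := by
      simpa using card_biUnion_le_card_mul (range (k + 1)) _ M fun j _ => by
        rw [hGv]; exact hFM (s j)
    have h2 : #((range k).image u) ≤ k := by simpa using card_image_le (s := range k) (f := u)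
    have h3 := card_union_le ((range (k + 1)).biUnion fun j => (G j).verts) ((range k).image u)
    have h4 : (k + 1) * (M + 1) = (k + 1) * M + k + 1 := by ring
    change #W ≤ _ at h3
    omega
  let S : Finset V := W \ {(G 0).tip false, (G k).tip true}
  have hSc : 2 * #S ≤ 2 * e :=
    Nat.mul_le_mul_left 2 ((card_le_card sdiff_subset).trans hWc)
  obtain ⟨z, hz, hz'⟩ := exists_common_reachable hX hXmin hSc
    ((hG 0).mem_of_mem_verts ((hG 0).tip_mem_verts false))
    ((hG k).mem_of_mem_verts ((hG k).tip_mem_verts true))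
  obtain ⟨y, q, q', hq, hq', hqq', hqS, hqS'⟩ := exists_merging_isDipath (fun _ _ h => h.1) hz hz'
  have hSfree : ∀ v, v ∉ S → v = (G 0).tip false ∨ v = (G k).tip true ∨
      (∀ i ≤ k, v ∉ (G i).verts) ∧ ∀ j < k, v ≠ u j := by
    intro v hv
    by_cases hvW : v ∈ W
    · have : v ∈ ({(G 0).tip false, (G k).tip true} : Finset V) := by
        by_contra h
        exact hv (mem_sdiff.mpr ⟨hvW, h⟩)
      rw [mem_insert, mem_singleton] at this
      tauto
    · refine Or.inr (Or.inr ⟨fun i hi h => hvW ?_, fun j hj h => hvW ?_⟩)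
      · exact mem_union_left _ (mem_biUnion.mpr ⟨i, mem_range.mpr (by omega), h⟩)
      · exact mem_union_right _ (mem_image.mpr ⟨j, mem_range.mpr hj, h.symm⟩)
  refine containsSubdivision_of_fork_chain hb (fun i _ => hG i)
    (fun i _ c => (hFlen (s i) (c == o i)).1) ?_ ?_ ?_ huinj hq hq' hqq' ?_
  · intro i hi j hj hne
    rw [hGv, hGv]
    exact hFdisj _ _ fun h => hne (hs i hi j hj h)
  · intro j hj
    obtain ⟨h1, h2⟩ := hu j hj
    refine ⟨?_, ?_⟩
    · simpa [G, Fork.relabel] using hNadj _ _ _ h1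
    · simpa [G, Fork.relabel] using hNadj _ _ _ h2
  · intro j hj i hi
    rw [hGv]
    exact huF j hj i hi
  · rintro v (hv | hv)
    · rcases hqS v hv with h | ⟨_, h⟩
      · exact Or.inl h
      · exact hSfree v h.2
    · rcases hqS' v hv with h | ⟨_, h⟩
      · exact Or.inr (Or.inl h)
      · exact hSfree v h.2

end

theorem theorem2p2 :
    ∃ C : ℕ, ∀ a b : ℕ, 2 ≤ a → 1 ≤ b →
      ∀ (V : Type*) [Finite V] [Nonempty V] (D : Digraph V), D.IsLoopless →
        C * a * b ^ 7 ≤ D.minOutDegree →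
        ((4 * b ^ 2 : ℕ) : ℕ∞) ≤ D.directedGirth →
        D.ContainsSubdivision (orientedCycle a b) := by
  refine ⟨100, fun a b ha hb V _ _ D _ hdeg _ => ?_⟩
  refine Digraph.containsSubdivision_orientedCycle_of_le_outDegree (by omega) hb fun v => ?_
  calc 100 * a * b ^ 2 ≤ 100 * a * b ^ 7 := by gcongr; omega
    _ ≤ D.minOutDegree := hdeg
    _ ≤ D.outDegree v := ciInf_le (OrderBot.bddBelow _) v
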